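/- For integers $r,s,d\ge 0$ let $$P_{r,s}^{[d]}=\sum_{i=1}^{r}\prod_{j=1}^{d}x_{ji}+\sum_{i=1}^{s}y_i^{d}$$ be the polynomial with complex coefficients in the $rd+s$ distinct variables $x_{ji}$ ($1\le i\le r$, $1\le j\le d$) and $y_1,\dots,y_s$. For complex polynomials $f\in\mathbb{C}[U]$ and $g\in\mathbb{C}[W]$ on finite-dimensional complex vector spaces $U,W$, write $f\trianglelefteq_{\mathrm{aff}}g$ if $f$ lies in the closure of the set $\{\,v\mapsto g(Av+b)\;:\;A\colon U\to W\text{ linear},\ b\in W\,\}$, where the closure is taken in the Euclidean topology (coefficientwise convergence) on the polynomials on $U$ of bounded degree. Theorem (second exponential gap). If $P_{2,0}^{[d]}\trianglelefteq_{\mathrm{aff}}P_{1,2}^{[e]}$, then $e\ge 2^{\Omega(d)}$. Explicitly: there is an absolute constant $c>0$ such that for all integers $d\ge 2$ and $e\ge 0$, if $P_{2,0}^{[d]}\trianglelefteq_{\mathrm{aff}}P_{1,2}^{[e]}$, then $e\ge \exp(c\,d)$. -/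

import Mathlib

open MvPolynomial

/-- The polynomial `P_{r,s}^{[d]} = ∑_{i=1}^r ∏_{j=1}^d x_{ji} + ∑_{i=1}^s y_i^d` over `ℂ`, in the
`r * d + s` pairwise distinct variables `x_{ji}` (`Sum.inl (i, j)`) and `y_i` (`Sum.inr i`). -/
noncomputable def prodPlusPow (r s d : ℕ) : MvPolynomial ((Fin r × Fin d) ⊕ Fin s) ℂ :=
  ∑ i : Fin r, ∏ j : Fin d, X (Sum.inl (i, j)) + ∑ i : Fin s, X (Sum.inr i) ^ d

/-- The composition `g ∘ (v ↦ A v + b)`, as a polynomial: every variable `y_i` of `g` is replaced by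
the affine linear form `∑ j, A i j x_j + b i`. -/
noncomputable def affineSubst {σ τ : Type*} [Fintype σ] (A : Matrix τ σ ℂ) (b : τ → ℂ)
    (g : MvPolynomial τ ℂ) : MvPolynomial σ ℂ :=
  bind₁ (fun i => ∑ j, C (A i j) * X j + C (b i)) g

/-- `f ⊴_aff g`: the polynomial `f` lies in the (Euclidean) closure of the set of all compositions
of `g` with affine linear maps. Polynomials are identified with their coefficient families, and the
closure is taken in the topology of coefficientwise convergence. All compositions of `g` with affine
linear maps have degree at most `deg g`, and on the finite-dimensional space of the polynomials of
bounded degree this is the Euclidean topology. -/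
def AffineDegeneration {σ τ : Type*} [Fintype σ] (f : MvPolynomial σ ℂ) (g : MvPolynomial τ ℂ) :
    Prop :=
  (fun m : σ →₀ ℕ => coeff m f) ∈
    closure {φ : (σ →₀ ℕ) → ℂ | ∃ (A : Matrix τ σ ℂ) (b : τ → ℂ),
      φ = fun m => coeff m (affineSubst A b g)}

/-! Degenerations are read as limits along an ultrafilter of a product of `e` affine forms plus two
`e`-th powers. Restricting to the common kernel of the linear parts of the two powered forms turns
both powers into constants. Pivoting on entries of largest modulus keeps this parametrization
bounded, so it has a limit `H₀`, and it alters at most two coordinates. The limit on the slice is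
`sliceValue`, and the sum `c n` of the two constants either converges or diverges.

If `c n` converges, `sliceValue` is a constant plus a product of affine forms
(`exists_prod_eq_of_tendsto_prod`), which `sliceValue_ne_const_add_prod` excludes for `d ≥ 4`.

If `c n` diverges, the constant term `θ` of the product diverges too. After dividing by it, `θ`
times the elementary symmetric functions of the linear forms converge, so the Newton identities make
`θ` times their power sums converge. In degree `k ≥ d - 2` this presents a nonzero multiple of a
monomial in `k` distinct variables as a limit of scaled sums of `e` `k`-th powers. Its flattening
has rank `2 ^ k`, whereas one power contributes rank at most `k + 1`; hence `2 ^ k ≤ (k + 1) * e`.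
-/

open Filter Topology Matrix

/-! ### Degenerations as limits along an ultrafilter -/

/-- An affine substitution does not raise the total degree. -/
theorem totalDegree_affineSubst_le {σ τ : Type*} [Fintype σ] (A : Matrix τ σ ℂ) (b : τ → ℂ)
    (g : MvPolynomial τ ℂ) : (affineSubst A b g).totalDegree ≤ g.totalDegree := by
  have haff : ∀ i, (∑ j, C (A i j) * X j + C (b i) : MvPolynomial σ ℂ).totalDegree ≤ 1 := by
    intro i
    refine (totalDegree_add _ _).trans (max_le ?_ (by simp))
    refine totalDegree_finsetSum_le fun j _ => (totalDegree_mul _ _).trans ?_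
    simp
  rw [affineSubst, bind₁, aeval_def, eval₂_eq]
  refine totalDegree_finsetSum_le fun m hm => ?_
  refine (totalDegree_mul _ _).trans ?_
  simp only [algebraMap_eq, totalDegree_C, zero_add]
  refine (totalDegree_finsetProd _ _).trans (le_trans ?_ (le_totalDegree hm))
  rw [Finsupp.sum]
  refine Finset.sum_le_sum fun i _ => (totalDegree_pow _ _).trans ?_
  simpa using Nat.mul_le_mul_left (m i) (haff i)

theorem eval_affineSubst {σ τ : Type*} [Fintype σ] (A : Matrix τ σ ℂ) (b : τ → ℂ)
    (g : MvPolynomial τ ℂ) (z : σ → ℂ) :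
    eval z (affineSubst A b g) = eval (A *ᵥ z + b) g := by
  rw [affineSubst, ← MvPolynomial.coe_aeval_eq_eval, RingHom.coe_coe, aeval_bind₁,
    ← MvPolynomial.coe_aeval_eq_eval, RingHom.coe_coe]
  congr 2
  ext i
  simp [Matrix.mulVec, dotProduct]

theorem eval_eq_sum_of_totalDegree_le {σ : Type*} [Fintype σ] {f : MvPolynomial σ ℂ} {D : ℕ}
    (hf : ∀ m : σ →₀ ℕ, D < m.degree → coeff m f = 0) (z : σ → ℂ) :
    eval z f = ∑ m ∈ (Finsupp.finite_of_degree_le (σ := σ) D).toFinset,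
      coeff m f * ∏ i, z i ^ m i := by
  rw [eval_eq']
  refine Finset.sum_subset (fun m hm => ?_) fun m _ hm => ?_
  · simp only [Set.Finite.mem_toFinset, Set.mem_ofPred_eq]
    by_contra h
    exact (mem_support_iff.mp hm) (hf m (not_le.mp h))
  · rw [notMem_support_iff.mp hm, zero_mul]

/-- An affine degeneration is witnessed by affine substitutions indexed by an ultrafilter, and the
values then converge along all convergent families of points. -/
theorem AffineDegeneration.exists_ultrafilter {σ τ : Type} [Fintype σ] {f : MvPolynomial σ ℂ}
    {g : MvPolynomial τ ℂ} (h : AffineDegeneration f g) :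
    ∃ (I : Type) (𝒰 : Ultrafilter I) (A : I → Matrix τ σ ℂ) (b : I → τ → ℂ),
      ∀ (z : I → σ → ℂ) (z₀ : σ → ℂ), Tendsto z 𝒰 (𝓝 z₀) →
        Tendsto (fun n => eval (A n *ᵥ z n + b n) g) 𝒰 (𝓝 (eval z₀ f)) := by
  obtain ⟨𝒰, hS, hlim⟩ := mem_closure_iff_ultrafilter.mp h
  have hex : ∀ φ : (σ →₀ ℕ) → ℂ, ∃ (A : Matrix τ σ ℂ) (b : τ → ℂ),
      φ ∈ {φ : (σ →₀ ℕ) → ℂ | ∃ (A : Matrix τ σ ℂ) (b : τ → ℂ),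
        φ = fun m => coeff m (affineSubst A b g)} →
      φ = fun m => coeff m (affineSubst A b g) := by
    intro φ
    by_cases hφ : ∃ (A : Matrix τ σ ℂ) (b : τ → ℂ), φ = fun m => coeff m (affineSubst A b g)
    · obtain ⟨A, b, hAb⟩ := hφ
      exact ⟨A, b, fun _ => hAb⟩
    · exact ⟨0, 0, fun h' => (hφ h').elim⟩
  choose A b hAb using hex
  have hcoeff : ∀ m, Tendsto (fun φ => coeff m (affineSubst (A φ) (b φ) g)) 𝒰 (𝓝 (coeff m f)) := by
    intro m
    have h1 : Tendsto (fun φ : (σ →₀ ℕ) → ℂ => φ m) 𝒰 (𝓝 (coeff m f)) :=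
      ((continuous_apply m).tendsto _).comp hlim
    refine h1.congr' ?_
    filter_upwards [hS] with φ hφ
    exact congrFun (hAb φ hφ) m
  have hzero : ∀ p : MvPolynomial σ ℂ, p.totalDegree ≤ g.totalDegree →
      ∀ m : σ →₀ ℕ, g.totalDegree < m.degree → coeff m p = 0 := fun p hp m hm =>
    coeff_eq_zero_of_totalDegree_lt (hp.trans_lt (by simpa [Finsupp.degree_apply, Finsupp.sum] using hm))
  -- The degree bound passes to the limit, so all evaluations are sums over one fixed finite set of
  -- monomials.
  have hf : ∀ m : σ →₀ ℕ, g.totalDegree < m.degree → coeff m f = 0 := fun m hm =>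
    tendsto_nhds_unique (hcoeff m) (by
      simp_rw [hzero _ (totalDegree_affineSubst_le _ _ g) m hm]
      exact tendsto_const_nhds)
  refine ⟨_, 𝒰, A, b, fun z z₀ hz => ?_⟩
  simp_rw [← eval_affineSubst, eval_eq_sum_of_totalDegree_le hf,
    eval_eq_sum_of_totalDegree_le (hzero _ (totalDegree_affineSubst_le _ _ g))]
  refine tendsto_finsetSum _ fun m _ => (hcoeff m).mul (tendsto_finsetProd _ fun i _ => ?_)
  exact ((tendsto_pi_nhds.mp hz) i).pow _

/-- The family form of a degeneration of `P_{2,0}` from `P_{1,2}`. -/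
theorem exists_affine_families {d e : ℕ}
    (h : AffineDegeneration (prodPlusPow 2 0 d) (prodPlusPow 1 2 e)) :
    ∃ (I : Type) (𝒰 : Ultrafilter I) (L : I → Fin e → Fin 2 × Fin d → ℂ) (l : I → Fin e → ℂ)
      (a : I → Fin 2 → Fin 2 × Fin d → ℂ) (b : I → Fin 2 → ℂ),
      ∀ (z : I → Fin 2 × Fin d → ℂ) (z₀ : Fin 2 × Fin d → ℂ), Tendsto z 𝒰 (𝓝 z₀) →
        Tendsto (fun n => ∏ i, (L n i ⬝ᵥ z n + l n i) + ∑ i, (a n i ⬝ᵥ z n + b n i) ^ e) 𝒰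
          (𝓝 (∑ r, ∏ j, z₀ (r, j))) := by
  obtain ⟨I, 𝒰, A, b, hAb⟩ := h.exists_ultrafilter
  refine ⟨I, 𝒰, fun n i j => A n (Sum.inl (0, i)) (Sum.inl j), fun n i => b n (Sum.inl (0, i)),
    fun n i j => A n (Sum.inr i) (Sum.inl j), fun n i => b n (Sum.inr i), fun z z₀ hz => ?_⟩
  have := hAb (fun n => Sum.elim (z n) Fin.elim0) (Sum.elim z₀ Fin.elim0) (by
    rw [tendsto_pi_nhds] at hz ⊢
    rintro (i | i)
    · exact hz i
    · exact i.elim0)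
  simpa [prodPlusPow, Matrix.mulVec, dotProduct] using this

/-! ### Coefficient limits and Newton identities -/

/-- Pointwise convergence of polynomials of bounded degree is coefficientwise convergence. -/
theorem Polynomial.tendsto_coeff_of_tendsto_eval {I : Type*} {F : Filter I} {N : ℕ}
    {p : I → Polynomial ℂ} {q : Polynomial ℂ} (hp : ∀ n, (p n).natDegree ≤ N)
    (hq : q.natDegree ≤ N) (h : ∀ s : ℂ, Tendsto (fun n => (p n).eval s) F (𝓝 (q.eval s)))
    (j : ℕ) : Tendsto (fun n => (p n).coeff j) F (𝓝 (q.coeff j)) := by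
  have key : ∀ r : Polynomial ℂ, r.natDegree ≤ N → r.coeff j =
      ∑ i ∈ Finset.range (N + 1), r.eval (i : ℂ) *
        (Lagrange.basis (Finset.range (N + 1)) (fun i : ℕ => (i : ℂ)) i).coeff j := by
    intro r hr
    have hdeg : r.degree < (Finset.range (N + 1)).card := by
      rw [Finset.card_range]
      exact (Polynomial.degree_le_of_natDegree_le hr).trans_lt (by exact_mod_cast N.lt_succ_self)
    conv_lhs => rw [Lagrange.eq_interpolate (s := Finset.range (N + 1))
      (v := fun i : ℕ => (i : ℂ)) Nat.cast_injective.injOn hdeg]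
    simp [Lagrange.interpolate_apply]
  simp_rw [key q hq, fun n => key (p n) (hp n)]
  exact tendsto_finsetSum _ fun i _ => (h i).mul_const _

theorem Polynomial.coeff_prod_one_add_C_mul_X {ι : Type*} [Fintype ι] (x : ι → ℂ) (j : ℕ) :
    (∏ i, (1 + Polynomial.C (x i) * Polynomial.X)).coeff j =
      MvPolynomial.aeval x (esymm ι ℂ j) := by
  classical
  rw [Finset.prod_one_add, Polynomial.finsetSum_coeff, esymm, map_sum]
  simp_rw [Finset.prod_mul_distrib, Finset.prod_const, ← map_prod, Polynomial.coeff_C_mul_X_pow,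
    map_prod, MvPolynomial.aeval_X]
  rw [← Finset.sum_filter, Finset.powersetCard_eq_filter]
  simp_rw [eq_comm]

theorem Polynomial.natDegree_prod_one_add_C_mul_X_le {ι : Type*} (s : Finset ι) (x : ι → ℂ) :
    (∏ i ∈ s, (1 + Polynomial.C (x i) * Polynomial.X)).natDegree ≤ s.card := by
  refine (Polynomial.natDegree_prod_le _ _).trans ?_
  refine (Finset.sum_le_card_nsmul _ _ 1 fun i _ => ?_).trans (by simp)
  compute_degree

/-- If the elementary symmetric functions converge after scaling by a divergent factor, then so do
the power sums: all products in the Newton identities vanish in the limit. -/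
theorem tendsto_mul_psum_of_tendsto_mul_esymm {I ι : Type*} [Fintype ι] {F : Filter I}
    {x : I → ι → ℂ} {θ : I → ℂ} {γ : ℕ → ℂ} (hθ : Tendsto (fun n => ‖θ n‖) F atTop)
    (h : ∀ j, 0 < j → Tendsto (fun n => θ n * aeval (x n) (esymm ι ℂ j)) F (𝓝 (γ j)))
    (j : ℕ) (hj : 0 < j) :
    Tendsto (fun n => θ n * ∑ i, x n i ^ j) F (𝓝 ((-1) ^ (j + 1) * j * γ j)) := by
  have hinv : Tendsto (fun n => (θ n)⁻¹) F (𝓝 0) :=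
    tendsto_zero_iff_norm_tendsto_zero.mpr (by simpa [Function.comp_def] using tendsto_inv_atTop_zero.comp hθ)
  have hne : ∀ᶠ n in F, θ n ≠ 0 := by
    filter_upwards [hθ.eventually_gt_atTop 0] with n hn
    exact norm_pos_iff.mp hn
  have hes : ∀ j, 0 < j → Tendsto (fun n => aeval (x n) (esymm ι ℂ j)) F (𝓝 0) := by
    intro j hj
    have := hinv.mul (h j hj)
    rw [zero_mul] at this
    refine this.congr' ?_
    filter_upwards [hne] with n hn
    rw [inv_mul_cancel_left₀ hn]
  induction j using Nat.strong_induction_on with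
  | _ j ih =>
  have newton : ∀ n, θ n * ∑ i, x n i ^ j =
      (-1) ^ (j + 1) * j * (θ n * aeval (x n) (esymm ι ℂ j)) -
        ∑ a ∈ (Finset.HasAntidiagonal.antidiagonal j).filter (fun a => a.1 ∈ Set.Ioo 0 j),
          (-1) ^ a.1 * aeval (x n) (esymm ι ℂ a.1) * (θ n * ∑ i, x n i ^ a.2) := by
    intro n
    have hN := congrArg (aeval (x n)) (psum_eq_mul_esymm_sub_sum ι ℂ j hj)
    simp only [psum, map_sum, map_sub, map_mul, map_pow, map_neg, map_one, map_natCast,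
      aeval_X] at hN
    rw [hN, mul_sub, Finset.mul_sum]
    congr 1
    · ring
    · exact Finset.sum_congr rfl fun a _ => by ring
  simp_rw [newton]
  -- The single factor `θ` is attached to the power sum, which converges by induction; the
  -- elementary symmetric factor tends to zero.
  have hsum : Tendsto (fun n => ∑ a ∈ (Finset.HasAntidiagonal.antidiagonal j).filter (fun a => a.1 ∈ Set.Ioo 0 j),
      (-1) ^ a.1 * aeval (x n) (esymm ι ℂ a.1) * (θ n * ∑ i, x n i ^ a.2)) F (𝓝 0) := by
    have h0 : (0 : ℂ) = ∑ a ∈ (Finset.HasAntidiagonal.antidiagonal j).filter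
        (fun a : ℕ × ℕ => a.1 ∈ Set.Ioo 0 j), 0 := Finset.sum_const_zero.symm
    rw [h0]
    refine tendsto_finsetSum _ fun a ha => ?_
    rw [Finset.mem_filter, Finset.HasAntidiagonal.mem_antidiagonal, Set.mem_Ioo] at ha
    have := ((hes a.1 ha.2.1).const_mul ((-1) ^ a.1)).mul (ih a.2 (by omega) (by omega))
    simpa using this
  simpa using ((h j hj).const_mul ((-1) ^ (j + 1) * (j : ℂ))).sub hsum

/-! ### Flattening rank of a monomial -/

/-- Flattening bound: the monomial `∏ t_j` in `k` variables is not a limit of scaled sums of `e`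
`k`-th powers of linear forms unless `2 ^ k ≤ (k + 1) * e`. -/
theorem two_pow_le_of_tendsto_sum_pow {I κ : Type*} [Fintype κ] {F : Filter I} [F.NeBot] {e : ℕ}
    {lam : I → Fin e → (κ → ℂ) →ₗ[ℂ] ℂ} {θ : I → ℂ} {c : ℂ} (hc : c ≠ 0)
    (h : ∀ t : κ → ℂ, Tendsto (fun n => θ n * ∑ i, lam n i t ^ Fintype.card κ) F
      (𝓝 (c * ∏ j, t j))) :
    2 ^ Fintype.card κ ≤ (Fintype.card κ + 1) * e := by
  classical
  set k := Fintype.card κ with hk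
  by_contra hlt
  push Not at hlt
  -- Coordinate `j` of `u S + v T` is `±1` if `S` and `T` agree at `j` and `0` otherwise, so the
  -- limit matrix is diagonal and invertible.
  let u : Finset κ → κ → ℂ := fun S j => if j ∈ S then 1 else 0
  let v : Finset κ → κ → ℂ := fun S j => if j ∈ S then 0 else -1
  let M : I → Matrix (Finset κ) (Finset κ) ℂ := fun n =>
    Matrix.of fun S T => θ n * ∑ i, lam n i (u S + v T) ^ k
  let B : Matrix (Finset κ) (Finset κ) ℂ := Matrix.of fun S T => c * ∏ j, (u S + v T) j
  have hB : B = Matrix.diagonal fun S => c * ∏ j, (u S + v S) j := by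
    ext S T
    rw [Matrix.diagonal_apply]
    split_ifs with hST
    · subst hST; rfl
    · obtain ⟨j, hj⟩ : ∃ j, ¬ (j ∈ S ↔ j ∈ T) := by
        by_contra hcon
        push Not at hcon
        exact hST (Finset.ext hcon)
      have : (u S + v T) j = 0 := by
        by_cases h1 : j ∈ S <;> by_cases h2 : j ∈ T <;> simp_all [u, v]
      simp only [B, Matrix.of_apply]
      rw [Finset.prod_eq_zero (Finset.mem_univ j) this, mul_zero]
  have hdetB : B.det ≠ 0 := by
    rw [hB, Matrix.det_diagonal]
    refine Finset.prod_ne_zero_iff.mpr fun S _ => mul_ne_zero hc ?_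
    refine Finset.prod_ne_zero_iff.mpr fun j _ => ?_
    by_cases h1 : j ∈ S <;> simp [u, v, h1]
  have hdetM : ∀ n, (M n).det = 0 := by
    intro n
    by_contra hne
    -- The binomial expansion of each power separates `S` from `T` with `k + 1` terms.
    let P : Matrix (Finset κ) (Fin e × Fin (k + 1)) ℂ := Matrix.of fun S a =>
      θ n * lam n a.1 (u S) ^ (a.2 : ℕ)
    let Q : Matrix (Fin e × Fin (k + 1)) (Finset κ) ℂ := Matrix.of fun a T =>
      lam n a.1 (v T) ^ (k - a.2) * (k.choose a.2)
    have hPQ : M n = P * Q := by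
      ext S T
      simp only [M, P, Q, Matrix.of_apply, Matrix.mul_apply, Fintype.sum_prod_type, map_add,
        add_pow, Finset.mul_sum]
      refine Finset.sum_congr rfl fun i _ => ?_
      rw [Finset.sum_range]
      exact Finset.sum_congr rfl fun j _ => by ring
    have h1 : (M n).rank = 2 ^ k := by
      rw [Matrix.rank_of_isUnit _ ((Matrix.isUnit_iff_isUnit_det _).mpr (isUnit_iff_ne_zero.mpr hne)),
        Fintype.card_finset]
    have h2 : (M n).rank ≤ e * (k + 1) := by
      rw [hPQ]
      refine (Matrix.rank_mul_le_left P Q).trans ((Matrix.rank_le_card_width P).trans ?_)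
      simp
    rw [h1, mul_comm] at h2
    omega
  have hlim : Tendsto (fun n => (M n).det) F (𝓝 B.det) := by
    refine ((continuous_id.matrix_det).tendsto B).comp ?_
    refine tendsto_pi_nhds.mpr fun S => tendsto_pi_nhds.mpr fun T => ?_
    exact h (u S + v T)
  simp_rw [hdetM] at hlim
  exact hdetB (tendsto_nhds_unique hlim tendsto_const_nhds)

/-! ### Ultralimits of products of affine functions -/

theorem Ultrafilter.exists_tendsto_of_norm_le {I E : Type*} [NormedAddCommGroup E] [ProperSpace E]
    (𝒰 : Ultrafilter I) {x : I → E} {R : ℝ} (h : ∀ᶠ n in 𝒰, ‖x n‖ ≤ R) :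
    ∃ y, ‖y‖ ≤ R ∧ Tendsto x 𝒰 (𝓝 y) := by
  obtain ⟨y, hy, hlim⟩ := (isCompact_closedBall (0 : E) R).ultrafilter_le_nhds (𝒰.map x)
    (by
      rw [le_principal_iff]
      change ∀ᶠ n in 𝒰, x n ∈ Metric.closedBall 0 R
      simpa using h)
  exact ⟨y, by simpa using hy, hlim⟩

/-- An ultrafilter decides each bound, so oscillation between bounded and unbounded behaviour cannot
occur. -/
theorem Ultrafilter.tendsto_nhds_or_norm_atTop {I E : Type*} [NormedAddCommGroup E]
    [ProperSpace E] (𝒰 : Ultrafilter I) (x : I → E) :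
    (∃ y, Tendsto x 𝒰 (𝓝 y)) ∨ Tendsto (fun n => ‖x n‖) 𝒰 atTop := by
  by_cases h : ∃ R, ∀ᶠ n in 𝒰, ‖x n‖ ≤ R
  · obtain ⟨R, hR⟩ := h
    obtain ⟨y, -, hy⟩ := 𝒰.exists_tendsto_of_norm_le hR
    exact Or.inl ⟨y, hy⟩
  · push Not at h
    exact Or.inr (tendsto_atTop.mpr fun R => (h R).mono fun n hn => hn.le)

/-- Finitely many affine functions, none of them identically zero, have a common point of
nonvanishing. -/
theorem exists_forall_add_ne_zero {E ι : Type*} [AddCommGroup E] [Module ℂ E] (s : Finset ι)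
    (L : ι → E →ₗ[ℂ] ℂ) (m : ι → ℂ) (h : ∀ i ∈ s, ∃ t, L i t + m i ≠ 0) :
    ∃ t, ∀ i ∈ s, L i t + m i ≠ 0 := by
  classical
  induction s using Finset.induction_on with
  | empty => exact ⟨0, by simp⟩
  | insert i s _ ih =>
    obtain ⟨z, hz⟩ := ih fun j hj => h j (Finset.mem_insert_of_mem hj)
    obtain ⟨w, hw⟩ := h i (Finset.mem_insert_self i s)
    by_cases hi : L i z + m i = 0
    -- A small move from `z` towards `w` preserves the old nonvanishing conditions and makes the new
    -- function `τ` times its value at `w`.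
    · have hev : ∀ᶠ τ : ℂ in 𝓝[≠] 0, ∀ j ∈ s, L j (z + τ • (w - z)) + m j ≠ 0 := by
        rw [Finset.eventually_all]
        intro j hj
        refine eventually_nhdsWithin_of_eventually_nhds ?_
        have hcont : Continuous fun τ : ℂ => L j (z + τ • (w - z)) + m j := by
          simp only [map_add, map_smul, smul_eq_mul]
          fun_prop
        refine hcont.continuousAt.eventually_ne ?_
        simpa using hz j hj
      obtain ⟨τ, hτ, hτ0⟩ := (hev.and self_mem_nhdsWithin).exists
      refine ⟨z + τ • (w - z), fun j hj => ?_⟩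
      rcases Finset.mem_insert.mp hj with rfl | hj
      · have : L j (z + τ • (w - z)) + m j = τ * (L j w + m j) := by
          simp only [map_add, map_smul, smul_eq_mul, map_sub]
          linear_combination (1 - τ) * hi
        rw [this]
        exact mul_ne_zero hτ0 hw
      · exact hτ j hj
    · refine ⟨z, fun j hj => ?_⟩
      rcases Finset.mem_insert.mp hj with rfl | hj
      · exact hi
      · exact hz j hj

/-- A pointwise limit along an ultrafilter of products of affine functions is a multiple of a
product of affine functions. -/
theorem exists_prod_eq_of_tendsto_prod {I N ι : Type*} [Fintype N] [Fintype ι] (𝒰 : Ultrafilter I)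
    {L : I → ι → N → ℂ} {m : I → ι → ℂ} {G : (N → ℂ) → ℂ}
    (h : ∀ t, Tendsto (fun n => ∏ i, (L n i ⬝ᵥ t + m n i)) 𝒰 (𝓝 (G t))) :
    ∃ (s : ℂ) (K : ι → N → ℂ) (k : ι → ℂ),
      ∀ t, G t = s * ∏ i, (K i ⬝ᵥ t + k i) := by
  -- Scaling each factor to norm one gives nonzero limits by compactness; a zero factor becomes the
  -- scalar `0` times the unit vector `(0, 1)`.
  have hnorm : ∀ n i, ∃ (s : ℂ) (x : (N → ℂ) × ℂ), ‖x‖ = 1 ∧ (L n i, m n i) = s • x := by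
    intro n i
    by_cases h0 : (L n i, m n i) = 0
    · exact ⟨0, (0, 1), by simp [Prod.norm_def], by simpa using h0⟩
    · refine ⟨(‖(L n i, m n i)‖ : ℂ), (‖(L n i, m n i)‖ : ℂ)⁻¹ • (L n i, m n i), ?_, ?_⟩
      · rw [norm_smul, norm_inv, Complex.norm_real, norm_norm, inv_mul_cancel₀ (norm_ne_zero_iff.mpr h0)]
      · rw [smul_inv_smul₀]
        exact_mod_cast norm_ne_zero_iff.mpr h0
  choose s x hx hsx using hnorm
  have hlim : ∀ i, ∃ y : (N → ℂ) × ℂ, ‖y‖ = 1 ∧ Tendsto (fun n => x n i) 𝒰 (𝓝 y) := by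
    intro i
    obtain ⟨y, -, hy⟩ := 𝒰.exists_tendsto_of_norm_le (x := fun n => x n i) (R := 1)
      (Eventually.of_forall fun n => (hx n i).le)
    refine ⟨y, tendsto_nhds_unique hy.norm ?_, hy⟩
    simp_rw [hx]
    exact tendsto_const_nhds
  choose y hy hxy using hlim
  have hy0 : ∀ i, ∃ t, (y i).1 ⬝ᵥ t + (y i).2 ≠ 0 := by
    classical
    intro i
    by_contra hcon
    push Not at hcon
    have h2 : (y i).2 = 0 := by simpa using hcon 0
    have h1 : (y i).1 = 0 := by
      ext w
      simpa [h2] using hcon (Pi.single w 1)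
    have : y i = 0 := Prod.ext h1 h2
    simpa [this] using hy i
  have hP : ∀ t, Tendsto (fun n => ∏ i, ((x n i).1 ⬝ᵥ t + (x n i).2)) 𝒰
      (𝓝 (∏ i, ((y i).1 ⬝ᵥ t + (y i).2))) := by
    intro t
    refine tendsto_finsetProd _ fun i _ => ?_
    have hc : Continuous fun p : (N → ℂ) × ℂ => p.1 ⬝ᵥ t + p.2 := by
      unfold dotProduct
      fun_prop
    exact (hc.tendsto _).comp (hxy i)
  have hsplit : ∀ n t, ∏ i, (L n i ⬝ᵥ t + m n i) =
      (∏ i, s n i) * ∏ i, ((x n i).1 ⬝ᵥ t + (x n i).2) := by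
    intro n t
    rw [← Finset.prod_mul_distrib]
    refine Finset.prod_congr rfl fun i _ => ?_
    obtain ⟨h1, h2⟩ := Prod.ext_iff.mp (hsx n i)
    simp only [Prod.smul_fst, Prod.smul_snd] at h1 h2
    rw [h1, h2, smul_dotProduct, smul_eq_mul, smul_eq_mul, mul_add]
  obtain ⟨t₀, ht₀⟩ := exists_forall_add_ne_zero Finset.univ
    (fun i => dotProductBilin ℂ ℂ (y i).1) (fun i => (y i).2) (fun i _ => hy0 i)
  have hne : ∏ i, ((y i).1 ⬝ᵥ t₀ + (y i).2) ≠ 0 := Finset.prod_ne_zero_iff.mpr ht₀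
  -- The product of the scalars is controlled at one point where no limit factor vanishes.
  have hs : Tendsto (fun n => ∏ i, s n i) 𝒰 (𝓝 (G t₀ / ∏ i, ((y i).1 ⬝ᵥ t₀ + (y i).2))) := by
    refine ((h t₀).div (hP t₀) hne).congr' ?_
    filter_upwards [(hP t₀).eventually_ne hne] with n hn
    rw [Pi.div_apply, hsplit, mul_div_cancel_right₀ _ hn]
  refine ⟨G t₀ / ∏ i, ((y i).1 ⬝ᵥ t₀ + (y i).2), fun i => (y i).1, fun i => (y i).2, fun t => tendsto_nhds_unique (h t) ?_⟩
  simp_rw [hsplit]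
  exact hs.mul (hP t)

/-! ### The case of divergent constants -/

/-- If products of `e` affine functions plus divergent constants converge to a function which
along every ray from the origin starts with `∏ t_j` in degree `k`, then `2 ^ k ≤ (k + 1) * e`. -/
theorem two_pow_le_of_tendsto_prod_add {I κ : Type*} [Fintype κ] {F : Filter I} [F.NeBot] {e : ℕ}
    (hκ : 0 < Fintype.card κ) {lam : I → Fin e → (κ → ℂ) →ₗ[ℂ] ℂ} {m : I → Fin e → ℂ} {c : I → ℂ}
    (hc : Tendsto (fun n => ‖c n‖) F atTop) {g : (κ → ℂ) → ℂ} {N : ℕ}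
    (hg : ∀ t, ∃ q : Polynomial ℂ, q.natDegree ≤ N ∧ q.coeff 0 = ∏ j, t j ∧
      ∀ s : ℂ, g (s • t) = s ^ Fintype.card κ * q.eval s)
    (h : ∀ t, Tendsto (fun n => ∏ i, (lam n i t + m n i) + c n) F (𝓝 (g t))) :
    2 ^ Fintype.card κ ≤ (Fintype.card κ + 1) * e := by
  set k := Fintype.card κ with hk
  have hg0 : g 0 = 0 := by
    obtain ⟨q, -, -, hq⟩ := hg 0
    simpa [hκ.ne'] using hq 0
  set θ : I → ℂ := fun n => ∏ i, m n i with hθdef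
  have hθc : Tendsto (fun n => θ n + c n) F (𝓝 0) := by simpa [hg0] using h 0
  have hθ : Tendsto (fun n => ‖θ n‖) F atTop := by
    refine tendsto_atTop_mono' F ?_ (tendsto_atTop_add_const_right F (-1) hc)
    filter_upwards [hθc.norm.eventually (gt_mem_nhds (by simp : ‖(0 : ℂ)‖ < 1))] with n hn
    have := norm_sub_le (θ n + c n) (θ n)
    rw [add_sub_cancel_left] at this
    linarith
  have hm : ∀ᶠ n in F, ∀ i, m n i ≠ 0 := by
    filter_upwards [hθ.eventually_gt_atTop 0] with n hn i
    exact Finset.prod_ne_zero_iff.mp (norm_pos_iff.mp hn) i (Finset.mem_univ i)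
  have hlim : ∀ t, Tendsto (fun n => θ n * (∏ i, (1 + (m n i)⁻¹ * lam n i t) - 1)) F (𝓝 (g t)) := by
    intro t
    have := (h t).sub hθc
    rw [sub_zero] at this
    refine this.congr' ?_
    filter_upwards [hm] with n hn
    rw [mul_sub, hθdef, ← Finset.prod_mul_distrib]
    have : ∀ i, m n i * (1 + (m n i)⁻¹ * lam n i t) = lam n i t + m n i := fun i => by
      rw [mul_add, mul_inv_cancel_left₀ (hn i)]; ring
    simp_rw [this]
    ring
  refine two_pow_le_of_tendsto_sum_pow (lam := fun n i => (m n i)⁻¹ • lam n i) (θ := θ) (F := F)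
    (c := (-1) ^ (k + 1) * k) (by simp [hκ.ne']) fun t => ?_
  obtain ⟨q, hqdeg, hq0, hq⟩ := hg t
  -- Along the ray `s • t` both sides are polynomials in `s` of bounded degree, and the coefficient
  -- of `s ^ j` on the left is `θ` times the `j`-th elementary symmetric function.
  have hes : ∀ j, 0 < j → Tendsto (fun n => θ n *
      aeval (fun i => (m n i)⁻¹ * lam n i t) (esymm (Fin e) ℂ j)) F
        (𝓝 ((Polynomial.X ^ k * q).coeff j)) := by
    intro j hj
    have := Polynomial.tendsto_coeff_of_tendsto_eval (F := F) (N := e + (k + N))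
      (p := fun n => Polynomial.C (θ n) *
        (∏ i, (1 + Polynomial.C ((m n i)⁻¹ * lam n i t) * Polynomial.X) - 1))
      (q := Polynomial.X ^ k * q) (fun n => ?_) ?_ (fun s => ?_) j
    · refine this.congr fun n => ?_
      rw [Polynomial.coeff_C_mul, Polynomial.coeff_sub, Polynomial.coeff_prod_one_add_C_mul_X,
        Polynomial.coeff_one, if_neg hj.ne', sub_zero]
    · refine (Polynomial.natDegree_C_mul_le _ _).trans ((Polynomial.natDegree_sub_le _ _).trans ?_)
      have := Polynomial.natDegree_prod_one_add_C_mul_X_le Finset.univ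
        (fun i => (m n i)⁻¹ * lam n i t)
      simp only [Finset.card_univ, Fintype.card_fin] at this
      simp only [Polynomial.natDegree_one]
      omega
    · refine Polynomial.natDegree_mul_le.trans ?_
      rw [Polynomial.natDegree_X_pow]
      omega
    · have := hlim (s • t)
      rw [hq] at this
      simpa [Polynomial.eval_prod, mul_assoc, mul_comm, mul_left_comm] using this
  have := tendsto_mul_psum_of_tendsto_mul_esymm hθ hes k hκ
  have hcoeff : (Polynomial.X ^ k * q).coeff k = ∏ j, t j := by
    rw [← hq0]
    simpa using Polynomial.coeff_X_pow_mul q k 0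
  rw [hcoeff] at this
  simpa using this

/-! ### Bounded elimination of two linear forms -/

/-- Elimination along an entry of largest absolute value. -/
theorem exists_pivot {N : Type*} [Fintype N] [DecidableEq N] [Nonempty N] (α : N → ℂ) :
    ∃ (u : N) (E : Matrix N N ℂ), (∀ w w', ‖E w w'‖ ≤ 2) ∧
      (∀ w, w ≠ u → E w = Pi.single w 1) ∧ α ᵥ* E = 0 := by
  obtain ⟨u, hu⟩ := Finite.exists_max fun w => ‖α w‖
  -- Row `u` subtracts `α / α u`, whose entries have modulus at most one by the choice of `u`. If `α
  -- u = 0` then `α = 0`, and division by zero makes the matrix the identity.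
  refine ⟨u, 1 - Matrix.of fun w w' => if w = u then α w' / α u else 0, fun w w' => ?_,
    fun w hw => ?_, ?_⟩
  · have h1 : ‖(1 : Matrix N N ℂ) w w'‖ ≤ 1 := by
      rw [Matrix.one_apply]
      split_ifs <;> simp
    have h2 : ‖(if w = u then α w' / α u else 0 : ℂ)‖ ≤ 1 := by
      split_ifs
      · rw [norm_div]
        exact div_le_one_of_le₀ (hu w') (norm_nonneg _)
      · simp
    exact (norm_sub_le _ _).trans (by simpa [one_add_one_eq_two] using add_le_add h1 h2)
  · ext w'
    simp [hw, Matrix.one_apply, Pi.single_apply, eq_comm (a := w')]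
  · ext w'
    rw [vecMul_sub, vecMul_one]
    have : (α ᵥ* Matrix.of fun w w' => if w = u then α w' / α u else 0) w' =
        α u * (α w' / α u) := by
      simp [vecMul, dotProduct]
    rw [Pi.sub_apply, this, Pi.zero_apply]
    by_cases h0 : α u = 0
    · have : α w' = 0 := norm_le_zero_iff.mp ((hu w').trans (by simp [h0]))
      simp [this]
    · rw [mul_div_cancel₀ _ h0, sub_self]

/-- A bounded parametrization of the common kernel of two linear forms which is the identity in all
but two coordinates. -/
theorem exists_pivot_pair {N : Type*} [Fintype N] [DecidableEq N] [Nonempty N]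
    (α : Fin 2 → N → ℂ) :
    ∃ (u v : N) (H : Matrix N N ℂ), (∀ w w', ‖H w w'‖ ≤ Fintype.card N * 4) ∧
      (∀ w, w ≠ u → w ≠ v → H w = Pi.single w 1) ∧ ∀ i, α i ᵥ* H = 0 := by
  obtain ⟨u, E, hE, hEu, hα⟩ := exists_pivot (α 0)
  obtain ⟨v, E', hE', hEv, hβ⟩ := exists_pivot (α 1 ᵥ* E)
  refine ⟨u, v, E * E', fun w w' => ?_, fun w hu hv => ?_, fun i => ?_⟩
  · rw [Matrix.mul_apply]
    refine (norm_sum_le_of_le _ fun x _ => ?_).trans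
      (by rw [Finset.sum_const, Finset.card_univ, nsmul_eq_mul])
    rw [norm_mul]
    exact (mul_le_mul (hE _ _) (hE' _ _) (norm_nonneg _) (by norm_num)).trans (by norm_num)
  · rw [← hEv w hv]
    ext w'
    simp [Matrix.mul_apply, hEu w hu, Pi.single_apply]
  · fin_cases i
    · simp [← vecMul_vecMul, hα]
    · simpa [← vecMul_vecMul] using hβ

/-! ### The restriction of the two products to the slice -/

section Slice

variable {d : ℕ} {u v : Fin 2 × Fin d} {H : Matrix (Fin 2 × Fin d) (Fin 2 × Fin d) ℂ}

/-- The columns of a row of the variables of `P_{2,0}` that avoid two given positions. -/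
def freeColumns (u v : Fin 2 × Fin d) (r : Fin 2) : Finset (Fin d) :=
  Finset.univ.filter fun j => (r, j) ≠ u ∧ (r, j) ≠ v

theorem le_card_freeColumns_add_two (u v : Fin 2 × Fin d) (r : Fin 2) :
    d ≤ (freeColumns u v r).card + 2 := by
  classical
  have hsub : (Finset.univ : Finset (Fin d)) ⊆ freeColumns u v r ∪ {u.2, v.2} := by
    intro j _
    by_cases h1 : (r, j) = u
    · simp [← h1]
    · by_cases h2 : (r, j) = v
      · simp [← h2]
      · simp [freeColumns, h1, h2]
  have h := (Finset.card_le_card hsub).trans (Finset.card_union_le _ _)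
  have h2 : ({u.2, v.2} : Finset (Fin d)).card ≤ 2 := Finset.card_le_two
  simp only [Finset.card_univ, Fintype.card_fin] at h
  omega

/-- The point of the affine slice with parameter `t`: the coordinates `u` and `v` are affine
functions of `t` with constant term one. -/
def slicePoint (u v : Fin 2 × Fin d) (H : Matrix (Fin 2 × Fin d) (Fin 2 × Fin d) ℂ)
    (t : Fin 2 × Fin d → ℂ) : Fin 2 × Fin d → ℂ :=
  (fun w => if w = u ∨ w = v then 1 else 0) + H *ᵥ t

/-- The restriction of `P_{2,0}` to the slice. -/
def sliceValue (u v : Fin 2 × Fin d) (H : Matrix (Fin 2 × Fin d) (Fin 2 × Fin d) ℂ)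
    (t : Fin 2 × Fin d → ℂ) : ℂ :=
  ∑ r, ∏ j, slicePoint u v H t (r, j)

theorem slicePoint_of_mem_freeColumns (hH : ∀ w, w ≠ u → w ≠ v → H w = Pi.single w 1)
    {r : Fin 2} {j : Fin d} (hj : j ∈ freeColumns u v r) (t : Fin 2 × Fin d → ℂ) :
    slicePoint u v H t (r, j) = t (r, j) := by
  simp only [freeColumns, Finset.mem_filter, Finset.mem_univ, true_and] at hj
  simp [slicePoint, hj.1, hj.2, mulVec, hH _ hj.1 hj.2]

theorem slicePoint_of_notMem_freeColumns {r : Fin 2} {j : Fin d} (hj : j ∉ freeColumns u v r)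
    (t : Fin 2 × Fin d → ℂ) : slicePoint u v H t (r, j) = 1 + (H *ᵥ t) (r, j) := by
  simp only [freeColumns, Finset.mem_filter, Finset.mem_univ, true_and] at hj
  have : (r, j) = u ∨ (r, j) = v := by tauto
  simp [slicePoint, this]

theorem prod_slicePoint_eq_zero (hH : ∀ w, w ≠ u → w ≠ v → H w = Pi.single w 1)
    {r : Fin 2} {j : Fin d} (hj : j ∈ freeColumns u v r) {t : Fin 2 × Fin d → ℂ}
    (ht : t (r, j) = 0) : ∏ j, slicePoint u v H t (r, j) = 0 :=
  Finset.prod_eq_zero (Finset.mem_univ j) (by rw [slicePoint_of_mem_freeColumns hH hj, ht])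

theorem sliceValue_eq_zero (hH : ∀ w, w ≠ u → w ≠ v → H w = Pi.single w 1)
    {t : Fin 2 × Fin d → ℂ} (ht : ∀ r, ∃ j ∈ freeColumns u v r, t (r, j) = 0) :
    sliceValue u v H t = 0 := by
  refine Finset.sum_eq_zero fun r _ => ?_
  obtain ⟨j, hj, hj0⟩ := ht r
  exact prod_slicePoint_eq_zero hH hj hj0

theorem sliceValue_eq_prod (hH : ∀ w, w ≠ u → w ≠ v → H w = Pi.single w 1)
    {t : Fin 2 × Fin d → ℂ} {r r' : Fin 2} (hr : r' ≠ r) {j : Fin d} (hj : j ∈ freeColumns u v r')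
    (ht : t (r', j) = 0) : sliceValue u v H t = ∏ j, slicePoint u v H t (r, j) := by
  refine Finset.sum_eq_single r (fun b _ hb => ?_) (by simp)
  obtain rfl : b = r' := by omega
  exact prod_slicePoint_eq_zero hH hj ht

/-- Only row `r` survives. For small nonzero `τ` its free factors are nonzero multiples of `τ`, and
the others are close to their constant term one. -/
theorem exists_sliceValue_smul_ne_zero (hH : ∀ w, w ≠ u → w ≠ v → H w = Pi.single w 1)
    {t : Fin 2 × Fin d → ℂ} {r r' : Fin 2} (hr : r' ≠ r) {j : Fin d} (hj : j ∈ freeColumns u v r')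
    (ht : t (r', j) = 0) (hne : ∀ i ∈ freeColumns u v r, t (r, i) ≠ 0) :
    ∃ τ : ℂ, sliceValue u v H (τ • t) ≠ 0 := by
  have hev : ∀ᶠ τ : ℂ in 𝓝[≠] 0, ∀ i, slicePoint u v H (τ • t) (r, i) ≠ 0 := by
    rw [eventually_all]
    intro i
    by_cases hi : i ∈ freeColumns u v r
    · filter_upwards [self_mem_nhdsWithin] with τ hτ
      rw [slicePoint_of_mem_freeColumns hH hi]
      exact mul_ne_zero hτ (hne i hi)
    · simp_rw [slicePoint_of_notMem_freeColumns hi, mulVec_smul, Pi.smul_apply, smul_eq_mul]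
      refine eventually_nhdsWithin_of_eventually_nhds ?_
      have hc : Continuous fun τ : ℂ => 1 + τ * (H *ᵥ t) (r, i) := by fun_prop
      exact hc.continuousAt.eventually_ne (by simp)
  obtain ⟨τ, hτ⟩ := hev.exists
  refine ⟨τ, ?_⟩
  rw [sliceValue_eq_prod hH hr hj (by simp [ht])]
  exact Finset.prod_ne_zero_iff.mpr fun i _ => hτ i

/-- The restriction of `P_{2,0}` to the slice is not a constant plus a product of affine
functions. -/
theorem sliceValue_ne_const_add_prod (hd : 4 ≤ d)
    (hH : ∀ w, w ≠ u → w ≠ v → H w = Pi.single w 1) {ι : Type*} [Fintype ι] {c s : ℂ}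
    {K : ι → Fin 2 × Fin d → ℂ} {k : ι → ℂ}
    (h : ∀ t, sliceValue u v H t = c + s * ∏ i, (K i ⬝ᵥ t + k i)) : False := by
  have htwo : ∀ r, 1 < (freeColumns u v r).card := fun r => by
    have := le_card_freeColumns_add_two u v r
    omega
  have hex : ∀ r, ∃ i ∈ freeColumns u v r, ∃ j ∈ freeColumns u v r, i ≠ j := fun r => by
    obtain ⟨i, j, hi, hj, hij⟩ := Finset.one_lt_card_iff.mp (htwo r)
    exact ⟨i, hi, j, hj, hij⟩
  choose i hi j hj hij using hex
  obtain ⟨τ₀, hτ₀⟩ := exists_sliceValue_smul_ne_zero hH (r := 0) (r' := 1) (by decide) (hi 1)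
    (t := fun w => if w.1 = 0 then 1 else 0) (by simp) (by simp)
  by_cases hc : c = 0
  · subst hc
    simp only [zero_add] at h
    have hs : s ≠ 0 := by
      rintro rfl
      exact hτ₀ (by rw [h, zero_mul])
    -- The product vanishes on the codimension-two subspace where one free variable of each row is
    -- zero. Some factor must vanish identically there, so it is a linear form in those two
    -- variables.
    obtain ⟨m, hm⟩ : ∃ m, k m = 0 ∧ ∀ w, w ≠ (0, i 0) → w ≠ (1, i 1) → K m w = 0 := by
      by_contra hcon
      push Not at hcon
      let K' : ι → Fin 2 × Fin d → ℂ := fun m w =>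
        if w = (0, i 0) ∨ w = (1, i 1) then 0 else K m w
      obtain ⟨t, ht⟩ := exists_forall_add_ne_zero Finset.univ
        (fun m => dotProductBilin ℂ ℂ (K' m)) k (fun m _ => by
          by_cases hkm : k m = 0
          · obtain ⟨w, hw0, hw1, hw⟩ := hcon m hkm
            exact ⟨Pi.single w 1, by simpa [K', hw0, hw1, hkm] using hw⟩
          · exact ⟨0, by simpa using hkm⟩)
      let t' : Fin 2 × Fin d → ℂ := fun w => if w = (0, i 0) ∨ w = (1, i 1) then 0 else t w
      have htt : ∀ m, K m ⬝ᵥ t' = K' m ⬝ᵥ t := fun m => by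
        refine Finset.sum_congr rfl fun w _ => ?_
        simp only [K', t']
        split_ifs <;> simp
      have hG := h t'
      rw [sliceValue_eq_zero hH (fun r => ⟨i r, hi r, by fin_cases r <;> simp [t']⟩)] at hG
      simp_rw [htt] at hG
      exact mul_ne_zero hs (Finset.prod_ne_zero_iff.mpr ht) hG.symm
    obtain ⟨hkm, hm⟩ := hm
    have hdot : ∀ t, K m ⬝ᵥ t = K m (0, i 0) * t (0, i 0) + K m (1, i 1) * t (1, i 1) := fun t =>
      Fintype.sum_eq_add _ _ (by simp) fun w hw => by rw [hm w hw.1 hw.2, zero_mul]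
    have hzero : ∀ t, K m ⬝ᵥ t = 0 → ∀ τ : ℂ, sliceValue u v H (τ • t) = 0 := fun t ht τ => by
      rw [h, Finset.prod_eq_zero (Finset.mem_univ m), mul_zero]
      rw [dotProduct_smul, ht, hkm, smul_zero, zero_add]
    by_cases hA : K m (0, i 0) = 0
    · exact hτ₀ (hzero _ (by simp [hdot, hA]) τ₀)
    -- The entry at `(0, i 0)` puts the point on the zero hyperplane of factor `m`, while `(0, j 0)`
    -- stays zero and removes the first row.
    · obtain ⟨τ, hτ⟩ := exists_sliceValue_smul_ne_zero hH (r := 1) (r' := 0) (by decide) (hj 0)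
        (t := fun w => if w = (0, i 0) then -K m (1, i 1) / K m (0, i 0) else
          if w.1 = 1 then 1 else 0) (by simp [(hij 0).symm]) (by simp)
      refine hτ (hzero _ ?_ τ)
      rw [hdot]
      simp [mul_div_cancel₀ _ hA]
  -- On such a subspace the product equals the nonzero constant `-c / s`, so no factor has a zero
  -- there and each factor is constant on it. Two disjoint choices of the pair of variables then
  -- force every linear part to be zero.
  · have hvan : ∀ (f : Fin 2 → Fin d), (∀ r, f r ∈ freeColumns u v r) →
        ∀ m w, w ≠ (0, f 0) → w ≠ (1, f 1) → K m w = 0 := by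
      intro f hf m w hw0 hw1
      by_contra hne
      have hG := h (Pi.single w (-k m / K m w))
      rw [sliceValue_eq_zero hH (fun r => ⟨f r, hf r, by
        fin_cases r
        · simp [hw0.symm]
        · simp [hw1.symm]⟩), Finset.prod_eq_zero (Finset.mem_univ m)] at hG
      · exact hc (by simpa using hG.symm)
      · simp [mul_div_cancel₀ _ hne]
    have hK0 : ∀ m, K m = 0 := by
      intro m
      ext w
      by_cases hw : w ≠ (0, i 0) ∧ w ≠ (1, i 1)
      · exact hvan i hi m w hw.1 hw.2
      · refine hvan j hj m w ?_ ?_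
        · rintro rfl
          simp [(hij 0).symm] at hw
        · rintro rfl
          simp [(hij 1).symm] at hw
    have h0 : sliceValue u v H 0 = 0 := sliceValue_eq_zero hH fun r => ⟨i r, hi r, rfl⟩
    refine hτ₀ ?_
    rw [← h0, h, h]
    simp [hK0]

end Slice

/-! ### The dichotomy on the slice -/

/-- The inclusion of the free variables of the second row into all variables. -/
def extendFree {d : ℕ} (u v : Fin 2 × Fin d) :
    ({j // j ∈ freeColumns u v 1} → ℂ) →ₗ[ℂ] (Fin 2 × Fin d → ℂ) where
  toFun t w := if h : w.1 = 1 ∧ w.2 ∈ freeColumns u v 1 then t ⟨w.2, h.2⟩ else 0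
  map_add' s t := by
    ext w
    by_cases h : w.1 = 1 ∧ w.2 ∈ freeColumns u v 1 <;> simp [h]
  map_smul' s t := by
    ext w
    by_cases h : w.1 = 1 ∧ w.2 ∈ freeColumns u v 1 <;> simp [h]

/-- The free variable `i` of the first row is zero, so only the second product remains. Its nonfree
factors have constant term one, so its lowest-degree part is the monomial in the free variables. -/
theorem sliceValue_smul_extendFree {d : ℕ} {u v : Fin 2 × Fin d}
    {H : Matrix (Fin 2 × Fin d) (Fin 2 × Fin d) ℂ}
    (hH : ∀ w, w ≠ u → w ≠ v → H w = Pi.single w 1) {i : Fin d} (hi : i ∈ freeColumns u v 0)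
    (t : {j // j ∈ freeColumns u v 1} → ℂ) (s : ℂ) :
    sliceValue u v H (extendFree u v (s • t)) =
      s ^ Fintype.card {j // j ∈ freeColumns u v 1} * ((∏ j, t j) *
        ∏ j : {j // j ∉ freeColumns u v 1}, (1 + s * (H *ᵥ extendFree u v t) (1, ↑j))) := by
  have hsplit : ∀ f : Fin d → ℂ, ∏ j, f j = (∏ j : {j // j ∈ freeColumns u v 1}, f j) *
      ∏ j : {j // j ∉ freeColumns u v 1}, f j := fun f => by
    convert (Fintype.prod_subtype_mul_prod_subtype (fun j => j ∈ freeColumns u v 1) f).symm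
  rw [sliceValue_eq_prod hH (r := 1) (by decide) hi (by simp [extendFree]), hsplit, ← mul_assoc,
    ← Finset.card_univ, ← Finset.prod_const, ← Finset.prod_mul_distrib]
  congr 1
  · refine Finset.prod_congr rfl fun j _ => ?_
    rw [slicePoint_of_mem_freeColumns hH j.2]
    simp [extendFree]
  · refine Finset.prod_congr rfl fun j _ => ?_
    rw [slicePoint_of_notMem_freeColumns j.2, map_smul, mulVec_smul]
    rfl

theorem exists_two_pow_le {d e : ℕ} (hd : 4 ≤ d)
    (h : AffineDegeneration (prodPlusPow 2 0 d) (prodPlusPow 1 2 e)) :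
    ∃ k, d ≤ k + 2 ∧ 2 ^ k ≤ (k + 1) * e := by
  obtain ⟨I, 𝒰, L, l, a, b, hlim⟩ := exists_affine_families h
  have : Nonempty (Fin 2 × Fin d) := ⟨(0, ⟨0, by omega⟩)⟩
  choose u v H hbd hrow hker using fun n => exists_pivot_pair (a n)
  -- An ultrafilter on a finite set is principal, so the pivot positions are eventually constant.
  obtain ⟨⟨u₀, v₀⟩, huv⟩ := (𝒰.map fun n => (u n, v n)).eq_pure_of_finite
  have hev : ∀ᶠ n in 𝒰, u n = u₀ ∧ v n = v₀ := by
    have h1 : {(u₀, v₀)} ∈ 𝒰.map fun n => (u n, v n) := by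
      rw [huv]
      exact Ultrafilter.mem_pure.mpr rfl
    filter_upwards [Ultrafilter.mem_map.mp h1] with n hn
    simpa using hn
  have hconv : ∀ w w', ∃ y, Tendsto (fun n => H n w w') 𝒰 (𝓝 y) := fun w w' => by
    obtain ⟨y, -, hy⟩ := 𝒰.exists_tendsto_of_norm_le (Eventually.of_forall fun n => hbd n w w')
    exact ⟨y, hy⟩
  obtain ⟨H₀, hH₀⟩ : ∃ H₀ : Matrix (Fin 2 × Fin d) (Fin 2 × Fin d) ℂ,
      ∀ w w', Tendsto (fun n => H n w w') 𝒰 (𝓝 (H₀ w w')) := by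
    choose H₀ hH₀ using hconv
    exact ⟨Matrix.of H₀, hH₀⟩
  have hrow₀ : ∀ w, w ≠ u₀ → w ≠ v₀ → H₀ w = Pi.single w 1 := by
    intro w hwu hwv
    ext w'
    refine tendsto_nhds_unique (hH₀ w w') (tendsto_const_nhds.congr' ?_)
    filter_upwards [hev] with n hn
    rw [hrow n w (by rwa [hn.1]) (by rwa [hn.2])]
  let p : Fin 2 × Fin d → ℂ := fun w => if w = u₀ ∨ w = v₀ then 1 else 0
  -- Since `a n i ᵥ* H n = 0`, the powered forms do not depend on `t` along `p + H n *ᵥ t`; this is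
  -- their total contribution.
  let c : I → ℂ := fun n => ∑ i, (a n i ⬝ᵥ p + b n i) ^ e
  have hT : ∀ t, Tendsto (fun n => ∏ i, ((L n i ᵥ* H n) ⬝ᵥ t + (L n i ⬝ᵥ p + l n i)) + c n) 𝒰
      (𝓝 (sliceValue u₀ v₀ H₀ t)) := by
    intro t
    have hz : Tendsto (fun n => p + H n *ᵥ t) 𝒰 (𝓝 (slicePoint u₀ v₀ H₀ t)) := by
      refine tendsto_const_nhds.add (tendsto_pi_nhds.mpr fun w => ?_)
      change Tendsto (fun n => ∑ w', H n w w' * t w') 𝒰 (𝓝 (∑ w', H₀ w w' * t w'))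
      exact tendsto_finsetSum _ fun w' _ => (hH₀ w w').mul_const _
    refine (hlim _ _ hz).congr fun n => ?_
    simp only [c, dotProduct_add, dotProduct_mulVec, hker, zero_dotProduct, add_zero]
    congr 1
    exact Finset.prod_congr rfl fun i _ => by ring
  have hcard := le_card_freeColumns_add_two u₀ v₀
  rcases 𝒰.tendsto_nhds_or_norm_atTop c with ⟨c₀, hc₀⟩ | hc
  · obtain ⟨s, K, k, hprod⟩ := exists_prod_eq_of_tendsto_prod 𝒰
      (G := fun t => sliceValue u₀ v₀ H₀ t - c₀)
      (L := fun n i => L n i ᵥ* H n) (m := fun n i => L n i ⬝ᵥ p + l n i) fun t => by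
        simpa using (hT t).sub hc₀
    exact (sliceValue_ne_const_add_prod hd hrow₀
      fun t => by rw [← hprod t, add_sub_cancel]).elim
  · obtain ⟨i, hi⟩ := Finset.card_pos.mp (by have := hcard 0; omega :
      0 < (freeColumns u₀ v₀ 0).card)
    have hk : Fintype.card {j // j ∈ freeColumns u₀ v₀ 1} = (freeColumns u₀ v₀ 1).card :=
      Fintype.card_coe _
    refine ⟨Fintype.card {j // j ∈ freeColumns u₀ v₀ 1}, hk ▸ hcard 1, ?_⟩
    refine two_pow_le_of_tendsto_prod_add (F := (𝒰 : Filter I))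
      (by have := hcard 1; omega)
      (lam := fun n i => dotProductBilin ℂ ℂ (L n i ᵥ* H n) ∘ₗ extendFree u₀ v₀)
      (m := fun n i => L n i ⬝ᵥ p + l n i) hc
      (g := fun t => sliceValue u₀ v₀ H₀ (extendFree u₀ v₀ t))
      (N := Fintype.card {j // j ∉ freeColumns u₀ v₀ 1}) (fun t => ?_) (fun t => hT _)
    refine ⟨Polynomial.C (∏ j, t j) * ∏ j : {j // j ∉ freeColumns u₀ v₀ 1},
      (1 + Polynomial.C ((H₀ *ᵥ extendFree u₀ v₀ t) (1, ↑j)) * Polynomial.X),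
      ?_, ?_, fun s => ?_⟩
    · exact (Polynomial.natDegree_C_mul_le _ _).trans
        (Polynomial.natDegree_prod_one_add_C_mul_X_le _ _)
    · rw [Polynomial.coeff_C_mul, Polynomial.coeff_zero_eq_eval_zero, Polynomial.eval_prod]
      simp
    · rw [sliceValue_smul_extendFree hrow₀ hi]
      simp only [Polynomial.eval_prod, Polynomial.eval_mul, Polynomial.eval_C,
        Polynomial.eval_add, Polynomial.eval_one, Polynomial.eval_X]
      simp_rw [mul_comm s]

/-! ### Small degrees and the explicit constant -/

theorem two_le_of_affineDegeneration {d e : ℕ} (hd : 2 ≤ d)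
    (h : AffineDegeneration (prodPlusPow 2 0 d) (prodPlusPow 1 2 e)) : 2 ≤ e := by
  obtain ⟨I, 𝒰, L, l, a, b, hlim⟩ := exists_affine_families h
  by_contra he
  have hval : ∀ s : ℂ, Tendsto (fun n => ∏ i, (L n i ⬝ᵥ (fun _ => s) + l n i) +
      ∑ i, (a n i ⬝ᵥ (fun _ => s) + b n i) ^ e) 𝒰 (𝓝 (2 * s ^ d)) := fun s => by
    simpa [two_mul] using hlim (fun _ _ => s) (fun _ => s) tendsto_const_nhds
  -- For `e ≤ 1` the approximants are affine on the diagonal, so their second difference at `0, 1,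
  -- 2` vanishes, whereas that of `2 * s ^ d` is `2 * 2 ^ d - 4`.
  have h2 := ((hval 0).add (hval 2)).sub ((hval 1).const_mul 2)
  have hzero : ∀ n, (∏ i, (L n i ⬝ᵥ (fun _ => 0) + l n i) +
      ∑ i, (a n i ⬝ᵥ (fun _ => 0) + b n i) ^ e) + (∏ i, (L n i ⬝ᵥ (fun _ => 2) + l n i) +
      ∑ i, (a n i ⬝ᵥ (fun _ => 2) + b n i) ^ e) - 2 * (∏ i, (L n i ⬝ᵥ (fun _ => 1) + l n i) +
      ∑ i, (a n i ⬝ᵥ (fun _ => 1) + b n i) ^ e) = 0 := by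
    intro n
    obtain rfl | rfl : e = 0 ∨ e = 1 := by omega
    · simp
      norm_num
    · simp only [dotProduct, ← Finset.sum_mul, Fin.sum_univ_two, Finset.univ_unique,
        Finset.prod_singleton, pow_one]
      ring
  simp_rw [hzero] at h2
  have h3 := tendsto_nhds_unique h2 tendsto_const_nhds
  have h4 : (2 : ℂ) ^ d = 2 := by
    rw [zero_pow (by omega)] at h3
    linear_combination h3 / 2
  have h5 : 2 ^ d = 2 := by exact_mod_cast h4
  have h6 : 2 ^ 2 ≤ 2 ^ d := Nat.pow_le_pow_right (by norm_num) hd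
  omega

theorem succ_sq_le_two_pow {k : ℕ} (hk : 6 ≤ k) : (k + 1) ^ 2 ≤ 2 ^ k := by
  induction k, hk using Nat.le_induction with
  | base => norm_num
  | succ k hk ih =>
    rw [pow_succ 2]
    nlinarith

/-- The exponent `8` serves both ranges: for `d ≤ 8` it suffices that `e ≥ 2`; for larger `d`, `(k +
1) ^ 2 ≤ 2 ^ k` gives `2 ^ k ≤ e ^ 2`, and `d ≤ k + 2 ≤ 4 * k`. -/
theorem two_pow_le_pow_eight {d e : ℕ} (hd : 2 ≤ d)
    (h : AffineDegeneration (prodPlusPow 2 0 d) (prodPlusPow 1 2 e)) : 2 ^ d ≤ e ^ 8 := by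
  by_cases h8 : d ≤ 8
  · exact (Nat.pow_le_pow_right (by norm_num) h8).trans
      (Nat.pow_le_pow_left (two_le_of_affineDegeneration hd h) 8)
  · obtain ⟨k, hk, hke⟩ := exists_two_pow_le (by omega) h
    have h1 := succ_sq_le_two_pow (k := k) (by omega)
    have h2 : 2 ^ k ≤ e ^ 2 := by
      have h3 : 2 ^ k * 2 ^ k ≤ 2 ^ k * e ^ 2 := by
        calc 2 ^ k * 2 ^ k ≤ ((k + 1) * e) * ((k + 1) * e) := Nat.mul_le_mul hke hke
          _ = (k + 1) ^ 2 * e ^ 2 := by ring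
          _ ≤ 2 ^ k * e ^ 2 := Nat.mul_le_mul_right _ h1
      exact Nat.le_of_mul_le_mul_left h3 (by positivity)
    calc 2 ^ d ≤ 2 ^ (k * 4) := Nat.pow_le_pow_right (by norm_num) (by omega)
      _ = (2 ^ k) ^ 4 := pow_mul _ _ _
      _ ≤ (e ^ 2) ^ 4 := Nat.pow_le_pow_left h2 4
      _ = e ^ 8 := by ring

theorem mainTheorem11 :
    ∃ c : ℝ, 0 < c ∧ ∀ d e : ℕ, 2 ≤ d →
      AffineDegeneration (prodPlusPow 2 0 d) (prodPlusPow 1 2 e) →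
        Real.exp (c * d) ≤ e := by
  refine ⟨Real.log 2 / 8, by have := Real.log_pos one_lt_two; positivity, fun d e hd h => ?_⟩
  have h8 : (2 : ℝ) ^ d ≤ (e : ℝ) ^ 8 := by exact_mod_cast two_pow_le_pow_eight hd h
  refine le_of_pow_le_pow_left₀ (n := 8) (by norm_num) (Nat.cast_nonneg e) (le_of_eq_of_le ?_ h8)
  rw [← Real.exp_nat_mul, show ((8 : ℕ) : ℝ) * (Real.log 2 / 8 * d) = d * Real.log 2 by
    push_cast; ring, Real.exp_nat_mul, Real.exp_log two_pos]
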